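/- Let $f(u)=u^3-u$, so $f'(u)=3u^2-1$. Fix $a>0$ such that $f'(u)>0$ whenever $|u-1|<a$ or $|u+1|<a$, and a smooth cut-off $\chi:\mathbb R\to[0,1]$ with $\chi=0$ on $(-\infty,-1]$ and $\chi=1$ on $[1,\infty)$. For $\varepsilon,\ell>0$ with $\varepsilon/\ell$ small, let $\phi_\varepsilon(\cdot,\ell,\pm1)$ be the unique solution of $\varepsilon^2\phi_{xx}-f(\phi)=0$ on $|x|<\ell/2+\varepsilon$ with $\phi(\pm\ell/2)=0$, $\pm\phi_\varepsilon(x,\ell,\pm1)>0$ for $|x|<\ell/2$ and $|\phi_\varepsilon(0,\ell,\pm1)\mp1|<a$. For an integer $N\ge1$ and $\rho,\varepsilon>0$ let $\Omega_\rho$ be the set of $h=(h_1,\dots,h_N)$ with $\frac{\varepsilon}{2\rho}<h_1<\dots<h_N<1-\frac{\varepsilon}{2\rho}$ and $h_j-h_{j-1}>\frac{\varepsilon}{\rho}$ for $2\le j\le N$. For $h\in\Omega_\rho$ put $\ell_1=2h_1$, $\ell_{N+1}=2(1-h_N)$, $m_1=0$, $m_{N+1}=1$ and, for $2\le j\le N$,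 $\ell_j=h_j-h_{j-1}$, $m_j=\frac{h_{j-1}+h_j}2$, and define $u^h$ on $[0,1]$ by $$u^h(x)=\Big[1-\chi\Big(\tfrac{x-h_j}{\varepsilon}\Big)\Big]\phi_\varepsilon\big(x-m_j,\ell_j,(-1)^j\big)+\chi\Big(\tfrac{x-h_j}{\varepsilon}\Big)\phi_\varepsilon\big(x-m_{j+1},\ell_{j+1},(-1)^{j+1}\big),\qquad x\in[m_j,m_{j+1}],\ 1\le j\le N.$$ Given $\delta(\varepsilon)>0$ and $\mu(\varepsilon)>0$, let $S_\varepsilon^h$ be the Friedrichs extension in $L^2(0,1)$ of the symmetric, semibounded operator $$\phi\mapsto-\delta(\varepsilon)\Big(\varepsilon^2\phi''''-\big(f'(u^h)\phi'\big)'-\tfrac12\big(f'(u^h)\big)_{xx}\phi\Big)+\mu(\varepsilon)\Big(\varepsilon^2\phi''-f'(u^h)\phi\Big)$$ with domain $\{\phi\in H^4(0,1):\phi'(0)=\phi'(1)=\phi'''(0)=\phi'''(1)=0\}$. Theorem. There is $\rho_2>0$, depending only on $a$ and $\chi$, such that for every $C_0>0$ there is a constant $C>0$, depending only on $a$, $\chi$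 and $C_0$, with the following property. Let $\delta(\varepsilon)>0$ and $\mu(\varepsilon)>0$ satisfy $$\varepsilon^2\mu(\varepsilon)\ge C_0\,\delta(\varepsilon)\qquad\text{for all }\varepsilon>0 .$$ Then for all $N\ge1$, $0<\rho\le\rho_2$, $\varepsilon>0$ and $h\in\Omega_\rho$, every eigenvalue $\lambda_k$ of $S_\varepsilon^h$ satisfies $$\lambda_k\le C\mu(\varepsilon).$$ -/

import Mathlib

open Set Filter Topology MeasureTheory
open scoped ContDiff

noncomputable section

namespace CHAC

/-! ### The nonlinearity and the cut-off function -/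

/-- The bistable nonlinearity `f(u) = u³ - u`. -/
def f (u : ℝ) : ℝ := u ^ 3 - u

/-- Its derivative `f'(u) = 3u² - 1`. -/
def f' (u : ℝ) : ℝ := 3 * u ^ 2 - 1

theorem hasDerivAt_f (u : ℝ) : HasDerivAt f (f' u) u := by
  have h1 : HasDerivAt (fun x : ℝ => x ^ 3) (3 * u ^ 2) u := by
    simpa using hasDerivAt_pow 3 u
  exact h1.sub (hasDerivAt_id' u)

/-- `a > 0` is such that `f'(u) > 0` whenever `|u ± 1| < a`. -/
def IsWellRadius (a : ℝ) : Prop :=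
  0 < a ∧ ∀ u : ℝ, (|u - 1| < a ∨ |u + 1| < a) → 0 < f' u

/-- A smooth cut-off function `χ : ℝ → [0,1]`, equal to `0` on `(-∞,-1]` and to `1` on `[1,∞)`. -/
structure IsCutoff (χ : ℝ → ℝ) : Prop where
  smooth : ContDiff ℝ ∞ χ
  mem_Icc : ∀ x, χ x ∈ Icc (0 : ℝ) 1
  eq_zero : ∀ x, x ≤ -1 → χ x = 0
  eq_one : ∀ x, 1 ≤ x → χ x = 1

/-! ### The stationary profiles -/

/-- `φ` solves `ε² φ'' = f(φ)` on `|x| < ℓ/2 + ε` with `φ(±ℓ/2) = 0`, has the sign `s = ±1` on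
`|x| < ℓ/2`, and satisfies `|φ(0) - s| < a`. -/
structure IsProfile (a ε ℓ s : ℝ) (φ : ℝ → ℝ) : Prop where
  contDiffOn : ContDiffOn ℝ 2 φ (Ioo (-(ℓ / 2 + ε)) (ℓ / 2 + ε))
  ode : ∀ x ∈ Ioo (-(ℓ / 2 + ε)) (ℓ / 2 + ε), ε ^ 2 * iteratedDeriv 2 φ x - f (φ x) = 0
  left : φ (-(ℓ / 2)) = 0
  right : φ (ℓ / 2) = 0
  sign : ∀ x, |x| < ℓ / 2 → 0 < s * φ x
  center : |φ 0 - s| < a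

open Classical in
/-- The profile `φ_ε(·, ℓ, s)`. For `ε / ℓ` small there is exactly one such function on
`|x| < ℓ/2 + ε`; the values outside of this interval are never used. -/
def profile (a ε ℓ s : ℝ) : ℝ → ℝ :=
  if H : ∃ φ, IsProfile a ε ℓ s φ then H.choose else 0

/-! ### Layer positions and the approximate states -/

/-- The admissible layer positions `Ω_ρ` (for the given `ε`). The components `h₁, …, h_N` of the
mathematical notation are `h 0, …, h (N-1)`. -/
def Omega (N : ℕ) (ρ ε : ℝ) : Set (Fin N → ℝ) :=
  {h | (∀ i, ε / (2 * ρ) < h i ∧ h i < 1 - ε / (2 * ρ)) ∧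
    StrictMono h ∧
    ∀ i j : Fin N, (i : ℕ) + 1 = j → ε / ρ < h j - h i}

section States

variable {N : ℕ}

/-- `h_j` for `1 ≤ j ≤ N` (one-based). -/
def pos (h : Fin N → ℝ) (j : ℕ) : ℝ :=
  if hj : 1 ≤ j ∧ j ≤ N then h ⟨j - 1, by omega⟩ else 0

/-- `ℓ₁ = 2 h₁`, `ℓ_j = h_j - h_{j-1}` for `2 ≤ j ≤ N`, `ℓ_{N+1} = 2 (1 - h_N)`. -/
def len (h : Fin N → ℝ) (j : ℕ) : ℝ :=
  if j = 1 then 2 * pos h 1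
  else if j = N + 1 then 2 * (1 - pos h N)
  else pos h j - pos h (j - 1)

/-- `m₁ = 0`, `m_j = (h_{j-1} + h_j) / 2` for `2 ≤ j ≤ N`, `m_{N+1} = 1`. -/
def mid (h : Fin N → ℝ) (j : ℕ) : ℝ :=
  if j = 1 then 0
  else if j = N + 1 then 1
  else (pos h (j - 1) + pos h j) / 2

/-- The shifted profile `φ^j(x) = φ_ε(x - m_j, ℓ_j, (-1)^j)`. -/
def phiJ (a ε : ℝ) (h : Fin N → ℝ) (j : ℕ) (x : ℝ) : ℝ :=
  profile a ε (len h j) ((-1) ^ j) (x - mid h j)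

/-- The expression that defines `u^h` on `I_j = [m_j, m_{j+1}]`. -/
def piece (a : ℝ) (χ : ℝ → ℝ) (ε : ℝ) (h : Fin N → ℝ) (j : ℕ) (x : ℝ) : ℝ :=
  (1 - χ ((x - pos h j) / ε)) * phiJ a ε h j x
    + χ ((x - pos h j) / ε) * phiJ a ε h (j + 1) x

open Classical in
/-- The approximate state `u^h` on `[0,1]`: on `I_j`, `1 ≤ j ≤ N`, it is given by `piece … j`.
(At a common end point of two intervals the two expressions agree; off `[0,1]` the value is `0`.) -/
def uh (a : ℝ) (χ : ℝ → ℝ) (ε : ℝ) (h : Fin N → ℝ) (x : ℝ) : ℝ :=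
  if H : ∃ j, 1 ≤ j ∧ j ≤ N ∧ x ∈ Icc (mid h j) (mid h (j + 1)) then
    piece a χ ε h (Nat.find H) x
  else 0

end States

/-! ### The operator `S_ε^h` and its Friedrichs extension -/

/-- Lebesgue measure on `(0,1)`. -/
abbrev vol01 : Measure ℝ := volume.restrict (Ioo (0 : ℝ) 1)

/-- The real Hilbert space `L²(0,1)`. -/
abbrev L2 : Type := Lp ℝ 2 vol01

/-- `φ = (φ₀, …, φ₄)` lists a function `φ₀ ∈ H⁴(0,1)` and its derivatives: on `[0,1]` each of
`φ₀, …, φ₃` is the (absolutely continuous) primitive of the next one, and `φ₄ ∈ L²(0,1)`.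
So `φ₀, …, φ₃` are the continuous representatives on `[0,1]`. -/
structure IsH4 (φ : Fin 5 → ℝ → ℝ) : Prop where
  primitive : ∀ i : Fin 4, ∀ x ∈ Icc (0 : ℝ) 1,
    φ i.castSucc x = φ i.castSucc 0 + ∫ t in (0 : ℝ)..x, φ i.succ t
  memLp : MemLp (φ 4) 2 vol01

/-- The graph in `L²(0,1) × L²(0,1)` of the operator
`S φ = -δ (ε² φ'''' - (f'(u) φ')' - ½ (f'(u))'' φ) + μ (ε² φ'' - f'(u) φ)`
with domain `{φ ∈ H⁴(0,1) : φ'(0) = φ'(1) = φ'''(0) = φ'''(1) = 0}`. -/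
def graphS (δ μ ε : ℝ) (u : ℝ → ℝ) : Set (L2 × L2) :=
  {p | ∃ φ : Fin 5 → ℝ → ℝ, IsH4 φ ∧
    φ 1 0 = 0 ∧ φ 1 1 = 0 ∧ φ 3 0 = 0 ∧ φ 3 1 = 0 ∧
    p.1 =ᵐ[vol01] φ 0 ∧
    p.2 =ᵐ[vol01] fun x =>
      -δ * (ε ^ 2 * φ 4 x - deriv (fun y => f' (u y) * φ 1 y) x
          - 1 / 2 * iteratedDeriv 2 (fun y => f' (u y)) x * φ 0 x)
        + μ * (ε ^ 2 * φ 2 x - f' (u x) * φ 0 x)}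

/-- The domain of the closure of the quadratic form `q[x] = ⟨A x, x⟩` of a semibounded symmetric
operator `A` with graph `G`: the `x` that are limits of some `x_n` in the domain of `A` with
`q[x_n - x_m] → 0` as `n, m → ∞`. -/
def closedFormDomain {H : Type*} [NormedAddCommGroup H] [InnerProductSpace ℝ H]
    (G : Set (H × H)) : Set H :=
  {x | ∃ p : ℕ → H × H, (∀ n, p n ∈ G) ∧ Tendsto (fun n => (p n).1) atTop (𝓝 x) ∧
    Tendsto (fun nm : ℕ × ℕ =>
      inner ℝ ((p nm.1).2 - (p nm.2).2) ((p nm.1).1 - (p nm.2).1)) atTop (𝓝 0)}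

/-- The graph of the Friedrichs extension of a semibounded (from below or from above) densely
defined symmetric operator `A` with graph `G`: the restriction of the adjoint `A*` to the domain of
the closed form. -/
def friedrichsGraph {H : Type*} [NormedAddCommGroup H] [InnerProductSpace ℝ H]
    (G : Set (H × H)) : Set (H × H) :=
  {p | p.1 ∈ closedFormDomain G ∧ ∀ q ∈ G, inner ℝ p.1 q.2 = inner ℝ p.2 q.1}

/-- `lam` is an eigenvalue of the operator with graph `G`. -/
def IsEigenvalue {H : Type*} [NormedAddCommGroup H] [InnerProductSpace ℝ H]
    (G : Set (H × H)) (lam : ℝ) : Prop :=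
  ∃ x : H, x ≠ 0 ∧ (x, lam • x) ∈ G

end CHAC

end

namespace CHAC

/-! Write `W = f'(u^h)` and `V = W''`. Integration by parts gives `⟨Sφ,φ⟩ = -δε²‖φ''‖² - δ∫Wφ'² +
(δ/2)∫Vφ² - με²‖φ'‖² - μ∫Wφ²`. Since `W ≥ -1`, the only dangerous terms are `δ‖φ'‖²`, `(δ/2)∫Vφ²`
and `μ‖φ‖²`. The first is absorbed by `‖φ'‖² = -∫φ''φ ≤ ε²‖φ''‖² + ‖φ‖²/(4ε²)`. If `V ≤ K/ε²`, what
remains is at most `(μ + (1/4 + K/2)δ/ε²)‖φ‖²`, and `δ/ε² ≤ μ/C₀` (`formS_self_le`). The Friedrichs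
extension keeps upper bounds of the form (`le_of_isEigenvalue_friedrichsGraph`).

The bound on `V` must be uniform in `N`, `h` and `ε`. Conservation of energy along a profile gives
`|φ| ≤ 1`, `|φ'| ≤ 1/ε`, `|φ''| ≤ 1/ε²` (`IsProfile.isBoundedProfile`), and blending with `χ` costs
only constants depending on `χ` (`hasBoundedJet_blend`). These bounds hold off a countable set,
which is enough because `u^h` is continuous. -/

/-! ### Absolutely continuous primitives and `H⁴` functions. -/

theorem absolutelyContinuousOnInterval_congr {F G : ℝ → ℝ} {a b : ℝ}
    (hF : AbsolutelyContinuousOnInterval F a b) (h : ∀ x ∈ uIcc a b, F x = G x) :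
    AbsolutelyContinuousOnInterval G a b := by
  rw [absolutelyContinuousOnInterval_iff] at hF ⊢
  intro ε hε
  obtain ⟨δ, hδ, H⟩ := hF ε hε
  refine ⟨δ, hδ, fun E hE hs => ?_⟩
  have := H E hE hs
  convert this using 1
  refine Finset.sum_congr rfl fun i hi => ?_
  have h2 := hE.1 i hi
  rw [h _ h2.1, h _ h2.2]

/-- `F` is absolutely continuous on `[0,1]` with `F' = g` almost everywhere. -/
def IsPrimitive (F g : ℝ → ℝ) : Prop :=
  AbsolutelyContinuousOnInterval F 0 1 ∧ ∀ᵐ x ∂vol01, HasDerivAt F (g x) x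

theorem isPrimitive_of_eq_integral {F g : ℝ → ℝ} (hg : IntervalIntegrable g volume 0 1)
    (h : ∀ x ∈ Icc (0 : ℝ) 1, F x = F 0 + ∫ t in (0 : ℝ)..x, g t) : IsPrimitive F g := by
  have h01 : uIcc (0 : ℝ) 1 = Icc 0 1 := uIcc_of_le zero_le_one
  have hac := hg.absolutelyContinuousOnInterval_intervalIntegral (c := 0) (by simp)
  have hconst : AbsolutelyContinuousOnInterval (fun _ : ℝ => F 0) 0 1 :=
    (LipschitzWith.const (F 0)).lipschitzOnWith.absolutelyContinuousOnInterval
  refine ⟨absolutelyContinuousOnInterval_congr (hconst.fun_add hac)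
    (fun x hx => (h x (h01 ▸ hx)).symm), ?_⟩
  rw [ae_restrict_iff' measurableSet_Ioo]
  filter_upwards [hg.ae_hasDerivAt_integral] with x hx hxI
  have h1 := (hx (h01 ▸ Ioo_subset_Icc_self hxI) 0 (by simp)).const_add (F 0)
  refine h1.congr_of_eventuallyEq ?_
  filter_upwards [Ioo_mem_nhds hxI.1 hxI.2] with y hy
  exact h y (Ioo_subset_Icc_self hy)

theorem intervalIntegral_eq_vol01 (g : ℝ → ℝ) : ∫ x in (0 : ℝ)..1, g x = ∫ x, g x ∂vol01 := by
  rw [intervalIntegral.integral_of_le zero_le_one, integral_Ioc_eq_integral_Ioo]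

theorem intervalIntegrable_iff_vol01 {g : ℝ → ℝ} :
    IntervalIntegrable g volume 0 1 ↔ Integrable g vol01 := by
  rw [intervalIntegrable_iff_integrableOn_Ioo_of_le zero_le_one]; rfl

namespace IsPrimitive

variable {F G g k : ℝ → ℝ}

theorem continuousOn (hF : IsPrimitive F g) : ContinuousOn F (Icc 0 1) := by
  simpa using hF.1.continuousOn

theorem ae_deriv_eq (hF : IsPrimitive F g) : deriv F =ᵐ[vol01] g := by
  filter_upwards [hF.2] with x hx using hx.deriv

theorem integrable (hF : IsPrimitive F g) : Integrable g vol01 :=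
  (intervalIntegrable_iff_vol01.1 hF.1.intervalIntegrable_deriv).congr hF.ae_deriv_eq

theorem integral_mul (hF : IsPrimitive F g) (hG : IsPrimitive G k) :
    ∫ x, g x * G x ∂vol01 = F 1 * G 1 - F 0 * G 0 - ∫ x, F x * k x ∂vol01 := by
  have h := hG.1.integral_mul_deriv_eq_deriv_mul hF.1
  rw [intervalIntegral_eq_vol01, intervalIntegral_eq_vol01] at h
  rw [integral_congr_ae (g := fun x => G x * deriv F x), h,
    integral_congr_ae (f := fun x => deriv G x * F x) (g := fun x => F x * k x)]
  · ring
  · filter_upwards [hG.ae_deriv_eq] with x hx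
    rw [hx, mul_comm]
  · filter_upwards [hF.ae_deriv_eq] with x hx
    rw [hx, mul_comm]

end IsPrimitive

theorem integrable_mul_continuousOn {g G : ℝ → ℝ} (hg : Integrable g vol01)
    (hG : ContinuousOn G (Icc 0 1)) : Integrable (fun x => g x * G x) vol01 := by
  rw [← intervalIntegrable_iff_vol01] at hg ⊢
  exact hg.mul_continuousOn (by simpa using hG)

theorem integrable_of_continuousOn {G : ℝ → ℝ} (hG : ContinuousOn G (Icc 0 1)) :
    Integrable G vol01 :=
  (hG.integrableOn_Icc (μ := volume)).mono_set Ioo_subset_Icc_self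

namespace IsH4

variable {φ ψ : Fin 5 → ℝ → ℝ}

/-- `IsH4` assumes integrability only of `φ 4`, so regularity is passed downwards: each primitive is
continuous, hence integrable, which makes the next identity in `primitive` meaningful. -/
theorem isPrimitive_four (hφ : IsH4 φ) : IsPrimitive (φ 3) (φ 4) :=
  isPrimitive_of_eq_integral
    (intervalIntegrable_iff_vol01.2 (hφ.memLp.integrable one_le_two)) (hφ.primitive 3)

theorem isPrimitive_of_continuousOn (hφ : IsH4 φ) (i : Fin 4)
    (h : ContinuousOn (φ i.succ) (Icc 0 1)) : IsPrimitive (φ i.castSucc) (φ i.succ) :=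
  isPrimitive_of_eq_integral
    (intervalIntegrable_iff_vol01.2 (integrable_of_continuousOn h)) (hφ.primitive i)

theorem isPrimitive_three (hφ : IsH4 φ) : IsPrimitive (φ 2) (φ 3) :=
  hφ.isPrimitive_of_continuousOn 2 hφ.isPrimitive_four.continuousOn

theorem isPrimitive_two (hφ : IsH4 φ) : IsPrimitive (φ 1) (φ 2) :=
  hφ.isPrimitive_of_continuousOn 1 hφ.isPrimitive_three.continuousOn

theorem isPrimitive_one (hφ : IsH4 φ) : IsPrimitive (φ 0) (φ 1) :=
  hφ.isPrimitive_of_continuousOn 0 hφ.isPrimitive_two.continuousOn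

end IsH4

/-! ### The quadratic form and its upper bound. -/

/-- The bilinear form of `S` on `H²(0,1)`, with `W = f'(u)` and `V = (f'(u))''`. -/
noncomputable def formS (δ μ ε : ℝ) (W V : ℝ → ℝ) (φ ψ : Fin 5 → ℝ → ℝ) : ℝ :=
  -δ * (ε ^ 2 * ∫ x, φ 2 x * ψ 2 x ∂vol01) - δ * (∫ x, W x * (φ 1 x * ψ 1 x) ∂vol01)
    + δ / 2 * (∫ x, V x * (φ 0 x * ψ 0 x) ∂vol01)
    - μ * (ε ^ 2 * ∫ x, φ 1 x * ψ 1 x ∂vol01) - μ * ∫ x, W x * (φ 0 x * ψ 0 x) ∂vol01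

theorem formS_comm (δ μ ε : ℝ) (W V : ℝ → ℝ) (φ ψ : Fin 5 → ℝ → ℝ) :
    formS δ μ ε W V φ ψ = formS δ μ ε W V ψ φ := by
  simp only [formS, mul_comm (φ 0 _), mul_comm (φ 1 _), mul_comm (φ 2 _)]

theorem integral_S_mul {δ μ ε : ℝ} {W V : ℝ → ℝ} {φ ψ : Fin 5 → ℝ → ℝ}
    (hW : AbsolutelyContinuousOnInterval W 0 1) (hV : Integrable V vol01)
    (hφ : IsH4 φ) (hψ : IsH4 ψ)
    (hφ1 : φ 1 0 = 0 ∧ φ 1 1 = 0 ∧ φ 3 0 = 0 ∧ φ 3 1 = 0) (hψ1 : ψ 1 0 = 0 ∧ ψ 1 1 = 0) :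
    ∫ x, (-δ * (ε ^ 2 * φ 4 x - deriv (fun y => W y * φ 1 y) x - 1 / 2 * V x * φ 0 x)
        + μ * (ε ^ 2 * φ 2 x - W x * φ 0 x)) * ψ 0 x ∂vol01 = formS δ μ ε W V φ ψ := by
  -- Absolute continuity of `W` makes the pointwise `deriv` in `graphS` the weak derivative of `W
  -- φ'`, so no singular part is lost.
  have hWp : IsPrimitive (fun y => W y * φ 1 y) (deriv fun y => W y * φ 1 y) := by
    have h := hW.fun_mul hφ.isPrimitive_two.1
    refine ⟨h, ?_⟩
    rw [ae_restrict_iff' measurableSet_Ioo]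
    filter_upwards [h.ae_differentiableAt] with x hx hxI
    exact (hx (by simpa using Ioo_subset_Icc_self hxI)).hasDerivAt
  have hWc : ContinuousOn W (Icc 0 1) := by simpa using hW.continuousOn
  have c0 := hφ.isPrimitive_one.continuousOn
  have d0 := hψ.isPrimitive_one.continuousOn
  have c2 := hφ.isPrimitive_three.continuousOn
  have i4 := integrable_mul_continuousOn hφ.isPrimitive_four.integrable d0
  have iW := integrable_mul_continuousOn hWp.integrable d0
  have iV := integrable_mul_continuousOn hV (c0.mul d0)
  have i2 := integrable_of_continuousOn (c2.mul d0)
  have i0 := integrable_of_continuousOn (hWc.mul (c0.mul d0))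
  have e4 : ∫ x, φ 4 x * ψ 0 x ∂vol01 = ∫ x, φ 2 x * ψ 2 x ∂vol01 := by
    rw [hφ.isPrimitive_four.integral_mul hψ.isPrimitive_one,
      hφ.isPrimitive_three.integral_mul hψ.isPrimitive_two, hφ1.2.2.1, hφ1.2.2.2, hψ1.1, hψ1.2]
    ring
  have eW : ∫ x, deriv (fun y => W y * φ 1 y) x * ψ 0 x ∂vol01
      = - ∫ x, W x * (φ 1 x * ψ 1 x) ∂vol01 := by
    rw [hWp.integral_mul hψ.isPrimitive_one, hφ1.1, hφ1.2.1]
    simp [mul_assoc]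
  have e2 : ∫ x, φ 2 x * ψ 0 x ∂vol01 = - ∫ x, φ 1 x * ψ 1 x ∂vol01 := by
    rw [hφ.isPrimitive_two.integral_mul hψ.isPrimitive_one, hφ1.1, hφ1.2.1]
    ring
  have key : ∀ x, (-δ * (ε ^ 2 * φ 4 x - deriv (fun y => W y * φ 1 y) x - 1 / 2 * V x * φ 0 x)
        + μ * (ε ^ 2 * φ 2 x - W x * φ 0 x)) * ψ 0 x
      = (-δ * ε ^ 2) * (φ 4 x * ψ 0 x) + δ * (deriv (fun y => W y * φ 1 y) x * ψ 0 x)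
        + (δ / 2) * (V x * (φ 0 x * ψ 0 x)) + (μ * ε ^ 2) * (φ 2 x * ψ 0 x)
        - μ * (W x * (φ 0 x * ψ 0 x)) := fun x => by ring
  have j1 := i4.const_mul (-δ * ε ^ 2)
  have j2 := j1.add (iW.const_mul δ)
  have j3 := j2.add (iV.const_mul (δ / 2))
  have j4 := j3.add (i2.const_mul (μ * ε ^ 2))
  calc _ = ∫ x, (-δ * ε ^ 2) * (φ 4 x * ψ 0 x) + δ * (deriv (fun y => W y * φ 1 y) x * ψ 0 x)
        + (δ / 2) * (V x * (φ 0 x * ψ 0 x)) + (μ * ε ^ 2) * (φ 2 x * ψ 0 x)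
        - μ * (W x * (φ 0 x * ψ 0 x)) ∂vol01 := integral_congr_ae (.of_forall key)
    _ = (-δ * ε ^ 2) * (∫ x, φ 4 x * ψ 0 x ∂vol01)
        + δ * (∫ x, deriv (fun y => W y * φ 1 y) x * ψ 0 x ∂vol01)
        + (δ / 2) * (∫ x, V x * (φ 0 x * ψ 0 x) ∂vol01)
        + (μ * ε ^ 2) * (∫ x, φ 2 x * ψ 0 x ∂vol01)
        - μ * (∫ x, W x * (φ 0 x * ψ 0 x) ∂vol01) := by
      have s1 := integral_sub j4 (i0.const_mul μ)
      have s2 := integral_add j3 (i2.const_mul (μ * ε ^ 2))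
      have s3 := integral_add j2 (iV.const_mul (δ / 2))
      have s4 := integral_add j1 (iW.const_mul δ)
      simp only [Pi.add_apply, Pi.mul_apply, integral_const_mul] at s1 s2 s3 s4 ⊢
      rw [s1, s2, s3, s4]
    _ = _ := by rw [e4, eW, e2, formS]; ring

theorem formS_self_le {δ μ ε K C₀ : ℝ} {W V : ℝ → ℝ} {φ : Fin 5 → ℝ → ℝ}
    (hW : ContinuousOn W (Icc 0 1)) (hV : Integrable V vol01) (hε : 0 < ε) (hδ : 0 < δ)
    (hμ : 0 < μ) (hC₀ : 0 < C₀) (hK : 0 ≤ K) (hδμ : C₀ * δ ≤ ε ^ 2 * μ)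
    (hW1 : ∀ x, -1 ≤ W x) (hVK : ∀ᵐ x ∂vol01, V x ≤ K / ε ^ 2)
    (hφ : IsH4 φ) (hφ1 : φ 1 0 = 0 ∧ φ 1 1 = 0) :
    formS δ μ ε W V φ φ ≤ (1 + (1 / 4 + K / 2) / C₀) * μ * ∫ x, φ 0 x * φ 0 x ∂vol01 := by
  have c0 := hφ.isPrimitive_one.continuousOn
  have c1 := hφ.isPrimitive_two.continuousOn
  have c2 := hφ.isPrimitive_three.continuousOn
  have i00 := integrable_of_continuousOn (c0.mul c0)
  have i11 := integrable_of_continuousOn (c1.mul c1)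
  have i22 := integrable_of_continuousOn (c2.mul c2)
  have i20 := integrable_of_continuousOn (c2.mul c0)
  set A0 := ∫ x, φ 0 x * φ 0 x ∂vol01 with hA0
  set A1 := ∫ x, φ 1 x * φ 1 x ∂vol01 with hA1
  set A2 := ∫ x, φ 2 x * φ 2 x ∂vol01 with hA2
  have p0 : 0 ≤ A0 := integral_nonneg fun x => mul_self_nonneg _
  have p1 : 0 ≤ A1 := integral_nonneg fun x => mul_self_nonneg _
  have e1 : ∫ x, φ 2 x * φ 0 x ∂vol01 = - A1 := by
    rw [hφ.isPrimitive_two.integral_mul hφ.isPrimitive_one, hφ1.1, hφ1.2]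
    ring
  have w1 : -A1 ≤ ∫ x, W x * (φ 1 x * φ 1 x) ∂vol01 := by
    rw [hA1, ← integral_neg]
    refine integral_mono i11.neg (integrable_of_continuousOn (hW.mul (c1.mul c1))) fun x => ?_
    have := mul_le_mul_of_nonneg_right (hW1 x) (mul_self_nonneg (φ 1 x))
    simpa using this
  have w0 : -A0 ≤ ∫ x, W x * (φ 0 x * φ 0 x) ∂vol01 := by
    rw [hA0, ← integral_neg]
    refine integral_mono i00.neg (integrable_of_continuousOn (hW.mul (c0.mul c0))) fun x => ?_
    have := mul_le_mul_of_nonneg_right (hW1 x) (mul_self_nonneg (φ 0 x))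
    simpa using this
  have v0 : ∫ x, V x * (φ 0 x * φ 0 x) ∂vol01 ≤ K / ε ^ 2 * A0 := by
    rw [hA0, ← integral_const_mul]
    refine integral_mono_ae (integrable_mul_continuousOn hV (c0.mul c0)) (i00.const_mul _) ?_
    filter_upwards [hVK] with x hx
    exact mul_le_mul_of_nonneg_right hx (mul_self_nonneg _)
  -- Interpolation: integrate the square `(εφ'' + φ/(2ε))²`, whose cross term `∫φ''φ` is `-A1`. The
  -- coefficient of `A2` matches the `-δε²‖φ''‖²` available in the form.
  have q : 0 ≤ ε ^ 2 * A2 - A1 + 1 / (4 * ε ^ 2) * A0 := by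
    have h : 0 ≤ ∫ x, (ε ^ 2 * (φ 2 x * φ 2 x) + φ 2 x * φ 0 x)
        + 1 / (4 * ε ^ 2) * (φ 0 x * φ 0 x) ∂vol01 := by
      refine integral_nonneg fun x => ?_
      have : (ε ^ 2 * (φ 2 x * φ 2 x) + φ 2 x * φ 0 x) + 1 / (4 * ε ^ 2) * (φ 0 x * φ 0 x)
          = (ε * φ 2 x + φ 0 x / (2 * ε)) ^ 2 := by
        field_simp
        ring
      simp only [Pi.zero_apply, this]
      positivity
    have s1 := integral_add ((i22.const_mul (ε ^ 2)).add i20) (i00.const_mul (1 / (4 * ε ^ 2)))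
    have s2 := integral_add (i22.const_mul (ε ^ 2)) i20
    simp only [Pi.add_apply, Pi.mul_apply, integral_const_mul] at s1 s2
    rw [s1, s2, e1] at h
    linarith
  have hδε : δ / ε ^ 2 ≤ μ / C₀ := by
    rw [div_le_div_iff₀ (by positivity) hC₀]
    linarith
  have t1 := mul_le_mul_of_nonneg_left w1 hδ.le
  have t2 := mul_le_mul_of_nonneg_left w0 hμ.le
  have t3 := mul_le_mul_of_nonneg_left v0 (half_pos hδ).le
  have t4 := mul_nonneg hδ.le q
  have t5 : 0 ≤ μ * (ε ^ 2 * A1) := by positivity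
  have t6 := mul_le_mul_of_nonneg_right hδε (show 0 ≤ (1 / 4 + K / 2) * A0 by positivity)
  have r1 : δ / 2 * (K / ε ^ 2 * A0) + δ * (1 / (4 * ε ^ 2) * A0)
      = δ / ε ^ 2 * ((1 / 4 + K / 2) * A0) := by
    field_simp
    ring
  have r2 : (1 + (1 / 4 + K / 2) / C₀) * μ * A0 = μ * A0 + μ / C₀ * ((1 / 4 + K / 2) * A0) := by
    field_simp
  rw [formS, r2, ← hA1, ← hA2]
  linarith

/-! ### Upper bounds and the Friedrichs extension. -/

/-- Eigenvalues of the Friedrichs extension do not exceed an upper bound of the quadratic form. -/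
theorem le_of_isEigenvalue_friedrichsGraph {H : Type*} [NormedAddCommGroup H]
    [InnerProductSpace ℝ H] {G : Set (H × H)} {M lam : ℝ}
    (hsymm : ∀ p ∈ G, ∀ q ∈ G, inner ℝ p.2 q.1 = inner ℝ q.2 p.1)
    (hle : ∀ p ∈ G, inner ℝ p.2 p.1 ≤ M * inner ℝ p.1 p.1)
    (h : IsEigenvalue (friedrichsGraph G) lam) : lam ≤ M := by
  obtain ⟨x, hx, ⟨p, hpG, hpx, hpq⟩, hadj⟩ := h
  by_contra! hlt
  have hxx : 0 < inner ℝ x x := real_inner_self_pos.2 hx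
  set η : ℝ := (lam - M) * inner ℝ x x with hη
  have hηpos : 0 < η := mul_pos (by linarith) hxx
  have hdiff : Tendsto (fun nm : ℕ × ℕ =>
      M * inner ℝ ((p nm.1).1 - (p nm.2).1) ((p nm.1).1 - (p nm.2).1)
        - inner ℝ ((p nm.1).2 - (p nm.2).2) ((p nm.1).1 - (p nm.2).1)) atTop (𝓝 0) := by
    have h1 : Tendsto (fun nm : ℕ × ℕ => (p nm.1).1 - (p nm.2).1) atTop (𝓝 0) := by
      rw [← prod_atTop_atTop_eq, ← sub_self x]
      exact (hpx.comp tendsto_fst).sub (hpx.comp tendsto_snd)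
    simpa using ((h1.inner h1).const_mul M).sub hpq
  -- Expand the form `M‖·‖² - q` at `p n - p m`. Its diagonal terms are nonnegative by `hle`, so
  -- smallness of the whole bounds the cross term from below. The limit `m → ∞` comes first, so that
  -- the adjoint relation for `x` can replace `⟨x, A p_n⟩` by `lam ⟨x, p_n⟩`. Then `n → ∞` gives
  -- `-η/2 ≤ -η`.
  have hev : ∀ᶠ n in atTop, ∀ᶠ m in atTop,
      -(η / 2) ≤ M * inner ℝ (p m).1 (p n).1 - inner ℝ (p m).1 (p n).2 := by
    have := hdiff.eventually (gt_mem_nhds hηpos)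
    rw [← prod_atTop_atTop_eq] at this
    refine this.curry.mono fun n hn => hn.mono fun m hm => ?_
    have a1 := hle _ (hpG n)
    have a2 := hle _ (hpG m)
    have a3 := hsymm _ (hpG n) _ (hpG m)
    simp only [inner_sub_left, inner_sub_right] at hm
    rw [real_inner_comm (p m).1 (p n).1, real_inner_comm (p n).2 (p m).1] at *
    linarith
  have hev2 : ∀ᶠ n in atTop, -(η / 2) ≤ M * inner ℝ x (p n).1 - lam * inner ℝ x (p n).1 := by
    refine hev.mono fun n hn => ?_
    have h3 := hadj _ (hpG n)
    rw [real_inner_smul_left] at h3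
    rw [← h3]
    exact ge_of_tendsto (((hpx.inner tendsto_const_nhds).const_mul M).sub
      (hpx.inner tendsto_const_nhds)) hn
  have h4 : -(η / 2) ≤ M * inner ℝ x x - lam * inner ℝ x x :=
    ge_of_tendsto (((tendsto_const_nhds.inner hpx).const_mul M).sub
      ((tendsto_const_nhds.inner hpx).const_mul lam)) hev2
  linarith

/-! ### A priori bounds for stationary profiles. -/

/-- If `|v'| ≤ K |v|` on an interval and `v` is positive at one point, it is positive throughout. -/
theorem pos_of_abs_deriv_le {v v' : ℝ → ℝ} {A B K : ℝ}
    (hv : ∀ x ∈ Icc A B, HasDerivAt v (v' x) x) (hK : ∀ x ∈ Icc A B, |v' x| ≤ K * |v x|)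
    {c : ℝ} (hc : c ∈ Icc A B) (hpos : 0 < v c) {x : ℝ} (hx : x ∈ Icc A B) : 0 < v x := by
  have hcont : ContinuousOn v (Icc A B) := fun y hy => (hv y hy).continuousAt.continuousWithinAt
  have hne : ∀ y ∈ Icc A B, v y ≠ 0 := by
    intro y hy h0
    have key : ∀ y ∈ Icc A B, |2 * v y * v' y| ≤ 2 * K * v y ^ 2 := fun y hy => by
      rw [abs_mul, abs_mul, abs_two, ← sq_abs (v y)]
      nlinarith [mul_le_mul_of_nonneg_left (hK y hy) (abs_nonneg (v y))]
    have hsub : interior (Icc A B) ⊆ Icc A B := interior_subset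
    have hd : ∀ s : ℝ, ∀ y ∈ Icc A B, HasDerivAt (fun y => v y ^ 2 * Real.exp (s * y))
        (2 * v y * v' y * Real.exp (s * y) + v y ^ 2 * (Real.exp (s * y) * s)) y := by
      intro s y hy
      have h1 := (hv y hy).pow 2
      have h2 := ((hasDerivAt_id y).const_mul s).exp
      exact (h1.mul h2).congr_deriv (by simp)
    have hcs : ∀ s : ℝ, ContinuousOn (fun y => v y ^ 2 * Real.exp (s * y)) (Icc A B) :=
      fun s y hy => (hd s y hy).continuousAt.continuousWithinAt
    -- Gronwall in both directions: the increasing weight excludes zeros to the right of `c`, the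
    -- decreasing one zeros to the left.
    have hmono : MonotoneOn (fun y => v y ^ 2 * Real.exp (2 * K * y)) (Icc A B) := by
      refine monotoneOn_of_deriv_nonneg (convex_Icc A B) (hcs _)
        (fun y hy => (hd _ y (hsub hy)).differentiableAt.differentiableWithinAt) fun y hy => ?_
      rw [(hd _ y (hsub hy)).deriv]
      have := neg_le_of_abs_le (key y (hsub hy))
      nlinarith [Real.exp_pos (2 * K * y)]
    have hanti : AntitoneOn (fun y => v y ^ 2 * Real.exp (-(2 * K) * y)) (Icc A B) := by
      refine antitoneOn_of_deriv_nonpos (convex_Icc A B) (hcs _)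
        (fun y hy => (hd _ y (hsub hy)).differentiableAt.differentiableWithinAt) fun y hy => ?_
      rw [(hd _ y (hsub hy)).deriv]
      have := le_of_abs_le (key y (hsub hy))
      nlinarith [Real.exp_pos (-(2 * K) * y)]
    have hc2 : ∀ s : ℝ, 0 < v c ^ 2 * Real.exp (s * c) := fun s => by positivity
    rcases le_total c y with h | h
    · have := hmono hc hy h
      simp only [h0] at this
      linarith [hc2 (2 * K)]
    · have := hanti hy hc h
      simp only [h0] at this
      linarith [hc2 (-(2 * K))]
  by_contra! hle
  have hI : uIcc c x ⊆ Icc A B := (convex_Icc A B).ordConnected.uIcc_subset hc hx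
  have h0 : (0 : ℝ) ∈ uIcc (v c) (v x) := by
    rw [uIcc_of_ge (hle.trans hpos.le)]
    exact ⟨hle, hpos.le⟩
  obtain ⟨y, hy, hy0⟩ := intermediate_value_uIcc (hcont.mono hI) h0
  exact hne y (hI hy) hy0

/-- A function that is twice differentiable on `I`, with the bounds of a stationary profile. -/
structure IsBoundedProfile (ε : ℝ) (I : Set ℝ) (φ : ℝ → ℝ) : Prop where
  hasDerivAt : ∀ x ∈ I, HasDerivAt φ (deriv φ x) x
  hasDerivAt_deriv : ∀ x ∈ I, HasDerivAt (deriv φ) (deriv (deriv φ) x) x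
  abs_le : ∀ x ∈ I, |φ x| ≤ 1
  abs_deriv_le : ∀ x ∈ I, |deriv φ x| ≤ 1 / ε
  abs_deriv_deriv_le : ∀ x ∈ I, |deriv (deriv φ) x| ≤ 1 / ε ^ 2

theorem IsBoundedProfile.mono {ε : ℝ} {I J : Set ℝ} {φ : ℝ → ℝ} (h : IsBoundedProfile ε I φ)
    (hJ : J ⊆ I) : IsBoundedProfile ε J φ :=
  ⟨fun x hx => h.1 x (hJ hx), fun x hx => h.2 x (hJ hx), fun x hx => h.3 x (hJ hx),
    fun x hx => h.4 x (hJ hx), fun x hx => h.5 x (hJ hx)⟩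

/-- The conserved energy `2ε²φ'² - (φ² - 1)²` is nonpositive, so `ε|φ'| ≤ |1 - φ²|`. Then `φ` cannot
reach `±1` by Gronwall, and the ODE bounds `φ''`. -/
theorem IsProfile.isBoundedProfile {a ε ℓ s : ℝ} {φ : ℝ → ℝ} (hφ : IsProfile a ε ℓ s φ)
    (hε : 0 < ε) (hℓ : 0 < ℓ) :
    IsBoundedProfile ε (Ioo (-(ℓ / 2 + ε)) (ℓ / 2 + ε)) φ := by
  set R := ℓ / 2 + ε with hR
  have hc : ∀ x ∈ Ioo (-R) R, ContDiffAt ℝ 2 φ x := fun x hx =>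
    hφ.contDiffOn.contDiffAt (Ioo_mem_nhds hx.1 hx.2)
  have hd : ∀ x ∈ Ioo (-R) R, HasDerivAt φ (deriv φ x) x := fun x hx =>
    ((hc x hx).differentiableAt (by norm_num)).hasDerivAt
  have hdd : ∀ x ∈ Ioo (-R) R, HasDerivAt (deriv φ) (deriv (deriv φ) x) x := fun x hx => by
    have h1 : ContDiffOn ℝ 1 (deriv φ) (Ioo (-R) R) :=
      hφ.contDiffOn.deriv_of_isOpen isOpen_Ioo (by norm_num)
    exact ((h1.contDiffAt (Ioo_mem_nhds hx.1 hx.2)).differentiableAt (by norm_num)).hasDerivAt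
  have hode : ∀ x ∈ Ioo (-R) R, ε ^ 2 * deriv (deriv φ) x = φ x ^ 3 - φ x := fun x hx => by
    have := hφ.ode x hx
    rw [iteratedDeriv_succ, iteratedDeriv_one] at this
    rw [f] at this
    linarith
  have hen : ∀ x ∈ Ioo (-R) R, HasDerivAt
      (fun y => 2 * ε ^ 2 * deriv φ y ^ 2 - (φ y ^ 2 - 1) ^ 2) 0 x := fun x hx => by
    have h1 := ((hdd x hx).pow 2).const_mul (2 * ε ^ 2)
    have h2 := (((hd x hx).pow 2).sub_const 1).pow 2
    refine (h1.sub h2).congr_deriv ?_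
    simp only [Pi.pow_apply]
    push_cast
    linear_combination (4 * deriv φ x) * hode x hx
  -- Rolle between the two zeros: at a critical point the energy is visibly nonpositive.
  obtain ⟨c, hc0, hc1⟩ : ∃ c ∈ Ioo (-(ℓ / 2)) (ℓ / 2), deriv φ c = 0 := by
    refine exists_deriv_eq_zero (by linarith) (fun y hy => ?_) (by rw [hφ.left, hφ.right])
    exact (hd y ⟨by linarith [hy.1], by linarith [hy.2]⟩).continuousAt.continuousWithinAt
  have hcI : c ∈ Ioo (-R) R := ⟨by linarith [hc0.1], by linarith [hc0.2]⟩
  have henle : ∀ x ∈ Ioo (-R) R, 2 * ε ^ 2 * deriv φ x ^ 2 ≤ (φ x ^ 2 - 1) ^ 2 := fun x hx => by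
    have := isOpen_Ioo.is_const_of_deriv_eq_zero isPreconnected_Ioo
      (fun y hy => (hen y hy).differentiableAt.differentiableWithinAt)
      (fun y hy => (hen y hy).deriv) hx hcI
    simp only [hc1] at this
    nlinarith [sq_nonneg (φ c ^ 2 - 1)]
  have hlt : ∀ x ∈ Ioo (-R) R, 0 < 1 - φ x ^ 2 := fun x hx => by
    have hm : ℓ / 2 ∈ Ioo (-R) R := ⟨by linarith, by linarith⟩
    set A := min x (ℓ / 2) with hA
    set B := max x (ℓ / 2) with hB
    have hsub : Icc A B ⊆ Ioo (-R) R :=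
      fun y hy => ⟨(lt_min hx.1 hm.1).trans_le hy.1, hy.2.trans_lt (max_lt hx.2 hm.2)⟩
    obtain ⟨M, hM⟩ := isCompact_Icc.exists_bound_of_continuousOn (s := Icc A B) (f := φ)
      fun y hy => (hd y (hsub hy)).continuousAt.continuousWithinAt
    -- Start from `ℓ/2`, where `φ = 0` and `v = 1`. The bound `M` depends on the compact interval,
    -- which is harmless since only the sign of `v` is kept.
    refine pos_of_abs_deriv_le (v := fun y => 1 - φ y ^ 2) (v' := fun y => -(2 * φ y * deriv φ y))
      (A := A) (B := B) (K := 2 * M / ε) (fun y hy => ?_) (fun y hy => ?_)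
      (c := ℓ / 2) ⟨min_le_right _ _, le_max_right _ _⟩ (by simp [hφ.right])
      ⟨min_le_left _ _, le_max_left _ _⟩
    · exact (((hd y (hsub hy)).pow 2).const_sub 1).congr_deriv (by simp)
    · have h1 : |deriv φ y| ≤ |1 - φ y ^ 2| / ε := by
        rw [le_div_iff₀ hε]
        refine abs_le_of_sq_le_sq' ?_ (abs_nonneg _) |>.2
        rw [sq_abs, mul_pow, sq_abs]
        nlinarith [henle y (hsub hy), sq_nonneg (ε * deriv φ y)]
      have h2 : |φ y| ≤ M := hM y hy
      calc |-(2 * φ y * deriv φ y)| = 2 * (|φ y| * |deriv φ y|) := by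
            rw [abs_neg, abs_mul, abs_mul, abs_two]; ring
        _ ≤ 2 * (M * (|1 - φ y ^ 2| / ε)) := by
            have := mul_le_mul h2 h1 (abs_nonneg _) ((abs_nonneg _).trans h2)
            linarith
        _ = 2 * M / ε * |1 - φ y ^ 2| := by ring
  have h1 : ∀ x ∈ Ioo (-R) R, |φ x| ≤ 1 := fun x hx => by
    rw [abs_le_one_iff_mul_self_le_one]
    nlinarith [hlt x hx]
  refine ⟨hd, hdd, h1, fun x hx => ?_, fun x hx => ?_⟩
  · rw [le_div_iff₀ hε]
    refine abs_le_of_sq_le_sq' ?_ zero_le_one |>.2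
    rw [mul_pow, sq_abs]
    nlinarith [henle x hx, hlt x hx, sq_nonneg (φ x), sq_nonneg (ε * deriv φ x)]
  · rw [le_div_iff₀ (by positivity)]
    have h2 : |deriv (deriv φ) x| * ε ^ 2 = |φ x ^ 3 - φ x| := by
      rw [← hode x hx, abs_mul, abs_of_nonneg (sq_nonneg ε), mul_comm]
    have h3 : φ x ^ 3 - φ x = -(φ x * (1 - φ x ^ 2)) := by ring
    rw [h2, h3, abs_neg, abs_mul, abs_of_pos (hlt x hx)]
    nlinarith [h1 x hx, hlt x hx, sq_nonneg (φ x), abs_nonneg (φ x)]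

theorem isBoundedProfile_profile {a ε ℓ s : ℝ} (hε : 0 < ε) (hℓ : 0 < ℓ) :
    IsBoundedProfile ε (Ioo (-(ℓ / 2 + ε)) (ℓ / 2 + ε)) (profile a ε ℓ s) := by
  rw [profile]
  split_ifs with H
  · exact H.choose_spec.isBoundedProfile hε hℓ
  -- The default value `0` satisfies the same bounds, so existence of a profile need not be proved.
  · have h0 : deriv (0 : ℝ → ℝ) = 0 := by
      ext x
      exact deriv_const x (0 : ℝ)
    have h : ∀ x, HasDerivAt (0 : ℝ → ℝ) 0 x := fun x => hasDerivAt_const x (0 : ℝ)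
    constructor <;> intro x _ <;> simp only [h0, Pi.zero_apply, abs_zero]
    · exact h x
    · exact h x
    all_goals positivity

theorem IsBoundedProfile.comp_sub {ε R m : ℝ} {φ : ℝ → ℝ}
    (hφ : IsBoundedProfile ε (Ioo (-R) R) φ) :
    IsBoundedProfile ε (Ioo (m - R) (m + R)) (fun x => φ (x - m)) := by
  have hI : ∀ x ∈ Ioo (m - R) (m + R), x - m ∈ Ioo (-R) R :=
    fun x hx => ⟨by linarith [hx.1], by linarith [hx.2]⟩
  have e1 : deriv (fun x => φ (x - m)) = fun x => deriv φ (x - m) := by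
    ext x; exact deriv_comp_sub_const _ m x
  have e2 : deriv (fun x => deriv φ (x - m)) = fun x => deriv (deriv φ) (x - m) := by
    ext x; exact deriv_comp_sub_const _ m x
  constructor <;> intro x hx <;> (try simp only [e1]) <;> (try simp only [e2])
  · exact (hφ.hasDerivAt _ (hI x hx)).comp_sub_const x m
  · exact (hφ.hasDerivAt_deriv _ (hI x hx)).comp_sub_const x m
  · exact hφ.abs_le _ (hI x hx)
  · exact hφ.abs_deriv_le _ (hI x hx)
  · exact hφ.abs_deriv_deriv_le _ (hI x hx)

theorem isBoundedProfile_phiJ {N : ℕ} {a ε : ℝ} {h : Fin N → ℝ} {j : ℕ} (hε : 0 < ε)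
    (hj : 0 < len h j) :
    IsBoundedProfile ε (Ioo (mid h j - (len h j / 2 + ε)) (mid h j + (len h j / 2 + ε)))
      (phiJ a ε h j) :=
  (isBoundedProfile_profile hε hj).comp_sub

/-! ### Pointwise derivative bounds and blending. -/

/-- `u` is twice differentiable at `x`, with `|u| ≤ 1`, `|u'| ≤ A` and `|u''| ≤ B` there. -/
def HasBoundedJet (A B : ℝ) (u : ℝ → ℝ) (x : ℝ) : Prop :=
  ∃ (u' : ℝ → ℝ) (d : ℝ), (∀ᶠ y in 𝓝 x, HasDerivAt u (u' y) y) ∧ HasDerivAt u' d x ∧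
    |u x| ≤ 1 ∧ |u' x| ≤ A ∧ |d| ≤ B

namespace HasBoundedJet

variable {A B A' B' x : ℝ} {u v : ℝ → ℝ}

theorem mono (h : HasBoundedJet A B u x) (hA : A ≤ A') (hB : B ≤ B') :
    HasBoundedJet A' B' u x := by
  obtain ⟨u', d, h1, h2, h3, h4, h5⟩ := h
  exact ⟨u', d, h1, h2, h3, h4.trans hA, h5.trans hB⟩

theorem congr (h : HasBoundedJet A B u x) (huv : v =ᶠ[𝓝 x] u) : HasBoundedJet A B v x := by
  obtain ⟨u', d, h1, h2, h3, h4, h5⟩ := h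
  refine ⟨u', d, ?_, h2, by rwa [huv.eq_of_nhds], h4, h5⟩
  filter_upwards [h1, huv.eventuallyEq_nhds] with y hy1 hy2
  exact hy1.congr_of_eventuallyEq hy2

theorem f'_comp (h : HasBoundedJet A B u x) :
    DifferentiableAt ℝ (fun y => f' (u y)) x ∧ |deriv (fun y => f' (u y)) x| ≤ 6 * A ∧
      |iteratedDeriv 2 (fun y => f' (u y)) x| ≤ 6 * A ^ 2 + 6 * B := by
  obtain ⟨u', d, h1, h2, h3, h4, h5⟩ := h
  have hd : ∀ᶠ y in 𝓝 x, HasDerivAt (fun y => f' (u y)) (6 * (u y * u' y)) y := by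
    filter_upwards [h1] with y hy
    refine (((hy.pow 2).const_mul 3).sub_const 1).congr_deriv ?_
    push_cast
    ring
  have hdx := hd.self_of_nhds
  have hA : 0 ≤ A := (abs_nonneg _).trans h4
  refine ⟨hdx.differentiableAt, ?_, ?_⟩
  · rw [hdx.deriv, abs_mul, abs_mul, abs_of_pos (by norm_num : (0 : ℝ) < 6)]
    have := mul_le_mul h3 h4 (abs_nonneg _) zero_le_one
    linarith
  · have he : deriv (fun y => f' (u y)) =ᶠ[𝓝 x] fun y => 6 * (u y * u' y) := by
      filter_upwards [hd] with y hy using hy.deriv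
    have hdd : HasDerivAt (fun y => 6 * (u y * u' y)) (6 * (u' x * u' x + u x * d)) x :=
      (h1.self_of_nhds.mul h2).const_mul 6
    rw [iteratedDeriv_succ, iteratedDeriv_one, he.deriv_eq, hdd.deriv]
    have e1 : |u' x * u' x| ≤ A ^ 2 := by
      rw [abs_mul, sq]
      exact mul_le_mul h4 h4 (abs_nonneg _) hA
    have e2 : |u x * d| ≤ 1 * B := by
      rw [abs_mul]
      exact mul_le_mul h3 h5 (abs_nonneg _) zero_le_one
    rw [abs_mul, abs_of_pos (by norm_num : (0 : ℝ) < 6)]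
    have := abs_add_le (u' x * u' x) (u x * d)
    linarith

end HasBoundedJet

theorem IsBoundedProfile.hasBoundedJet {ε x : ℝ} {I : Set ℝ} {φ : ℝ → ℝ}
    (hφ : IsBoundedProfile ε I φ) (hI : I ∈ 𝓝 x) :
    HasBoundedJet (1 / ε) (1 / ε ^ 2) φ x :=
  have hx := mem_of_mem_nhds hI
  ⟨deriv φ, _, mem_of_superset hI fun y hy => hφ.hasDerivAt y hy, hφ.hasDerivAt_deriv x hx,
    hφ.abs_le x hx, hφ.abs_deriv_le x hx, hφ.abs_deriv_deriv_le x hx⟩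

theorem IsCutoff.exists_deriv_bounds {χ : ℝ → ℝ} (hχ : IsCutoff χ) :
    ∃ X : ℝ, 0 ≤ X ∧ ∀ y ∈ Icc (-1 : ℝ) 1, |deriv χ y| ≤ X ∧ |deriv (deriv χ) y| ≤ X := by
  have h2 : ContDiff ℝ ∞ (deriv χ) := (contDiff_infty_iff_deriv.1 hχ.smooth).2
  have h3 : ContDiff ℝ ∞ (deriv (deriv χ)) := (contDiff_infty_iff_deriv.1 h2).2
  obtain ⟨M1, hM1⟩ := (isCompact_Icc (a := (-1 : ℝ)) (b := 1)).exists_bound_of_continuousOn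
    h2.continuous.continuousOn
  obtain ⟨M2, hM2⟩ := (isCompact_Icc (a := (-1 : ℝ)) (b := 1)).exists_bound_of_continuousOn
    h3.continuous.continuousOn
  refine ⟨max (max M1 M2) 0, le_max_right _ _, fun y hy => ⟨?_, ?_⟩⟩
  · exact (hM1 y hy).trans ((le_max_left _ _).trans (le_max_left _ _))
  · exact (hM2 y hy).trans ((le_max_right _ _).trans (le_max_left _ _))

theorem abs_convexComb_le {c p q P : ℝ} (hc : c ∈ Icc (0 : ℝ) 1) (hp : |p| ≤ P) (hq : |q| ≤ P) :
    |(1 - c) * p + c * q| ≤ P := by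
  have h1 := mul_le_mul_of_nonneg_left hp (sub_nonneg.2 hc.2)
  have h2 := mul_le_mul_of_nonneg_left hq hc.1
  calc |(1 - c) * p + c * q| ≤ |(1 - c) * p| + |c * q| := abs_add_le _ _
    _ = (1 - c) * |p| + c * |q| := by
      rw [abs_mul, abs_mul, abs_of_nonneg hc.1, abs_of_nonneg (sub_nonneg.2 hc.2)]
    _ ≤ P := by linarith

/-- Convex combinations keep the profile bounds. The extra terms are `χ'(q - p)/ε` in `u'`, and
`2χ'(q' - p')/ε` and `χ''(q - p)/ε²` in `u''`, contributing `2X` and `4X + 2X`. -/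
theorem hasBoundedJet_blend {χ p q : ℝ → ℝ} {ε b x X : ℝ} {I : Set ℝ} (hχ : IsCutoff χ)
    (hX : ∀ y ∈ Icc (-1 : ℝ) 1, |deriv χ y| ≤ X ∧ |deriv (deriv χ) y| ≤ X) (hε : 0 < ε)
    (hx : |x - b| ≤ ε) (hI : I ∈ 𝓝 x) (hp : IsBoundedProfile ε I p)
    (hq : IsBoundedProfile ε I q) :
    HasBoundedJet ((1 + 2 * X) / ε) ((1 + 6 * X) / ε ^ 2)
      (fun y => (1 - χ ((y - b) / ε)) * p y + χ ((y - b) / ε) * q y) x := by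
  have hxI := mem_of_mem_nhds hI
  have h2 : ContDiff ℝ ∞ (deriv χ) := (contDiff_infty_iff_deriv.1 hχ.smooth).2
  have hin : ∀ y, HasDerivAt (fun y => (y - b) / ε) (1 / ε) y := fun y =>
    ((hasDerivAt_id y).sub_const b).div_const ε
  have hc : ∀ y, HasDerivAt (fun y => χ ((y - b) / ε)) (deriv χ ((y - b) / ε) * (1 / ε)) y :=
    fun y => ((hχ.smooth.differentiable (by simp)).differentiableAt.hasDerivAt).comp y (hin y)
  have hc' : ∀ y, HasDerivAt (fun y => deriv χ ((y - b) / ε) * (1 / ε))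
      (deriv (deriv χ) ((y - b) / ε) * (1 / ε) * (1 / ε)) y := fun y =>
    (((h2.differentiable (by simp)).differentiableAt.hasDerivAt).comp y (hin y)).mul_const _
  have hz : (x - b) / ε ∈ Icc (-1 : ℝ) 1 := by
    rw [mem_Icc, ← abs_le, abs_div, abs_of_pos hε]
    exact (div_le_one hε).2 hx
  obtain ⟨X1, X2⟩ := hX _ hz
  have hX0 : 0 ≤ X := (abs_nonneg _).trans X1
  have hcx := hχ.mem_Icc ((x - b) / ε)
  have hε1 : (0 : ℝ) < 1 / ε := by positivity
  have b1 : |deriv χ ((x - b) / ε) * (1 / ε)| ≤ X * (1 / ε) := by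
    rw [abs_mul, abs_of_pos hε1]
    exact mul_le_mul_of_nonneg_right X1 hε1.le
  have b2 : |deriv (deriv χ) ((x - b) / ε) * (1 / ε) * (1 / ε)| ≤ X * (1 / ε) * (1 / ε) := by
    rw [abs_mul, abs_mul, abs_of_pos hε1]
    gcongr
  have d0 : |q x - p x| ≤ 2 := by
    have := abs_sub (q x) (p x)
    have := hp.abs_le x hxI
    have := hq.abs_le x hxI
    linarith
  have d1 : |deriv q x - deriv p x| ≤ 2 * (1 / ε) := by
    have := abs_sub (deriv q x) (deriv p x)
    have := hp.abs_deriv_le x hxI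
    have := hq.abs_deriv_le x hxI
    linarith
  refine ⟨fun y => ((1 - χ ((y - b) / ε)) * deriv p y + χ ((y - b) / ε) * deriv q y)
      + deriv χ ((y - b) / ε) * (1 / ε) * (q y - p y),
    ((1 - χ ((x - b) / ε)) * deriv (deriv p) x + χ ((x - b) / ε) * deriv (deriv q) x)
      + (2 * (deriv χ ((x - b) / ε) * (1 / ε) * (deriv q x - deriv p x))
      + deriv (deriv χ) ((x - b) / ε) * (1 / ε) * (1 / ε) * (q x - p x)),
    ?_, ?_, ?_, ?_, ?_⟩
  · filter_upwards [hI] with y hy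
    refine ((((hc y).const_sub 1).mul (hp.hasDerivAt y hy)).add
      ((hc y).mul (hq.hasDerivAt y hy))).congr_deriv ?_
    ring
  · refine (((((hc x).const_sub 1).mul (hp.hasDerivAt_deriv x hxI)).add
      ((hc x).mul (hq.hasDerivAt_deriv x hxI))).add
      ((hc' x).mul ((hq.hasDerivAt x hxI).sub (hp.hasDerivAt x hxI)))).congr_deriv ?_
    simp only [Pi.sub_apply]
    ring
  · exact abs_convexComb_le hcx (hp.abs_le x hxI) (hq.abs_le x hxI)
  · have t1 := abs_convexComb_le hcx (hp.abs_deriv_le x hxI) (hq.abs_deriv_le x hxI)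
    have t2 := mul_le_mul b1 d0 (abs_nonneg _) (by positivity)
    rw [← abs_mul] at t2
    refine (abs_add_le _ _).trans ((add_le_add t1 t2).trans_eq ?_)
    ring
  · have t1 := abs_convexComb_le hcx (hp.abs_deriv_deriv_le x hxI) (hq.abs_deriv_deriv_le x hxI)
    have t2 := mul_le_mul b1 d1 (abs_nonneg _) (by positivity)
    have t3 := mul_le_mul b2 d0 (abs_nonneg _) (by positivity)
    rw [← abs_mul] at t2 t3
    have t4 := mul_le_mul_of_nonneg_left t2 zero_le_two
    rw [← abs_two, ← abs_mul, abs_two] at t4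
    refine (abs_add_le _ _).trans ((add_le_add t1 ((abs_add_le _ _).trans
      (add_le_add t4 t3))).trans_eq ?_)
    ring

/-! ### Geometry of the layers -/

section Layers

variable {N : ℕ} {ρ ε : ℝ} {h : Fin N → ℝ}

theorem two_mul_lt_len (hε : 0 < ε) (hρ : 0 < ρ) (hρ2 : ρ ≤ 1 / 2) (hh : h ∈ Omega N ρ ε)
    (hN : 1 ≤ N) {j : ℕ} (hj1 : 1 ≤ j) (hj : j ≤ N + 1) : 2 * ε < len h j := by
  obtain ⟨hb, -, hd⟩ := hh
  -- Source of `ρ₂ = 1/2`: the transition zones `|x - h_j| ≤ ε` then avoid all the `m_i`.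
  have e1 : 2 * ε ≤ ε / ρ := by
    rw [le_div_iff₀ hρ]
    nlinarith
  have e2 : ε / (2 * ρ) = ε / ρ / 2 := by
    field_simp
  rw [len]
  split_ifs with c1 c2
  · rw [pos, dif_pos ⟨le_rfl, hN⟩]
    linarith [(hb ⟨1 - 1, by omega⟩).1]
  · rw [pos, dif_pos ⟨hN, le_rfl⟩]
    linarith [(hb ⟨N - 1, by omega⟩).2]
  · rw [pos, dif_pos ⟨hj1, by omega⟩, pos, dif_pos ⟨by omega, by omega⟩]
    have := hd ⟨j - 1 - 1, by omega⟩ ⟨j - 1, by omega⟩ (by simp only; omega)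
    linarith

theorem mid_one : mid h 1 = 0 := by simp [mid]

theorem mid_add_one (hN : 1 ≤ N) : mid h (N + 1) = 1 := by
  rw [mid, if_neg (by omega), if_pos rfl]

theorem mid_add_half_len {j : ℕ} (hj : j ≤ N) : mid h j + len h j / 2 = pos h j := by
  rw [mid, len]
  split_ifs with c1 c2
  · subst c1; ring
  · omega
  · ring

theorem mid_sub_half_len {j : ℕ} (hj1 : 1 ≤ j) : mid h (j + 1) - len h (j + 1) / 2 = pos h j := by
  rw [mid, len, Nat.add_sub_cancel]
  split_ifs with c1 c2
  · omega
  · obtain rfl : j = N := by omega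
    ring
  · ring

/-- The layers are separated by more than `2ε` from each other and from the end points. -/
structure IsSeparated (ε : ℝ) (h : Fin N → ℝ) : Prop where
  one_le : 1 ≤ N
  two_mul_lt_len : ∀ j, 1 ≤ j → j ≤ N + 1 → 2 * ε < len h j

namespace IsSeparated

theorem mid_add_lt_pos (hs : IsSeparated ε h) {j : ℕ} (hj1 : 1 ≤ j) (hj : j ≤ N) : mid h j + ε < pos h j := by
  have := hs.two_mul_lt_len j hj1 (by omega)
  have := mid_add_half_len (h := h) hj
  linarith

theorem pos_add_lt_mid (hs : IsSeparated ε h) {j : ℕ} (hj1 : 1 ≤ j) (hj : j ≤ N) : pos h j + ε < mid h (j + 1) := by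
  have := hs.two_mul_lt_len (j + 1) (by omega) (by omega)
  have := mid_sub_half_len (h := h) hj1
  linarith

theorem mid_lt_mid (hs : IsSeparated ε h) (hε : 0 < ε) {i j : ℕ} (hi : 1 ≤ i)
    (hij : i < j) (hj : j ≤ N + 1) :
    mid h i < mid h j := by
  induction j, hij using Nat.le_induction with
  | base => linarith [hs.mid_add_lt_pos hi (by omega), hs.pos_add_lt_mid hi (by omega)]
  | succ k hk ih =>
    have := ih (by omega)
    linarith [hs.mid_add_lt_pos (j := k) (by omega) (by omega),
      hs.pos_add_lt_mid (j := k) (by omega) (by omega)]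

theorem isBoundedProfile_left (hs : IsSeparated ε h) {a : ℝ} (hε : 0 < ε) {j : ℕ} (hj1 : 1 ≤ j)
    (hj : j ≤ N) :
    IsBoundedProfile ε (Ioo (mid h j - ε) (pos h j + ε)) (phiJ a ε h j) := by
  have hl := hs.two_mul_lt_len j hj1 (by omega)
  have := mid_add_half_len (h := h) hj
  exact (isBoundedProfile_phiJ hε (by linarith)).mono
    (Ioo_subset_Ioo (by linarith) (by linarith))

theorem isBoundedProfile_right (hs : IsSeparated ε h) {a : ℝ} (hε : 0 < ε) {j : ℕ} (hj1 : 1 ≤ j)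
    (hj : j ≤ N) :
    IsBoundedProfile ε (Ioo (pos h j - ε) (mid h (j + 1) + ε)) (phiJ a ε h (j + 1)) := by
  have hl := hs.two_mul_lt_len (j + 1) (by omega) (by omega)
  have := mid_sub_half_len (h := h) hj1
  exact (isBoundedProfile_phiJ hε (by linarith)).mono
    (Ioo_subset_Ioo (by linarith) (by linarith))

end IsSeparated

/-! ### Regularity of `u^h`. -/

variable {a : ℝ} {χ : ℝ → ℝ}

theorem IsCutoff.eq_zero_of_le (hχ : IsCutoff χ) (hε : 0 < ε) {x b : ℝ} (hx : x ≤ b - ε) :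
    χ ((x - b) / ε) = 0 :=
  hχ.eq_zero _ (by rw [div_le_iff₀ hε]; linarith)

theorem IsCutoff.eq_one_of_le (hχ : IsCutoff χ) (hε : 0 < ε) {x b : ℝ} (hx : b + ε ≤ x) :
    χ ((x - b) / ε) = 1 :=
  hχ.eq_one _ (by rw [le_div_iff₀ hε]; linarith)

theorem IsCutoff.piece_of_le (hχ : IsCutoff χ) (hε : 0 < ε) {x : ℝ} {j : ℕ}
    (hx : x ≤ pos h j - ε) : piece a χ ε h j x = phiJ a ε h j x := by
  simp [piece, hχ.eq_zero_of_le hε hx]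

theorem IsCutoff.piece_of_ge (hχ : IsCutoff χ) (hε : 0 < ε) {x : ℝ} {j : ℕ}
    (hx : pos h j + ε ≤ x) : piece a χ ε h j x = phiJ a ε h (j + 1) x := by
  simp [piece, hχ.eq_one_of_le hε hx]

theorem continuousAt_mul_of_abs_le {c p : ℝ → ℝ} {x : ℝ} (hc : ContinuousAt c x) (h0 : c x = 0)
    (h : ∀ᶠ y in 𝓝 x, |c y * p y| ≤ |c y|) : ContinuousAt (fun y => c y * p y) x := by
  rw [ContinuousAt, h0, zero_mul]
  refine squeeze_zero_norm' h ?_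
  have := hc.abs
  rw [ContinuousAt, h0, abs_zero] at this
  exact this

theorem abs_mul_le_of_abs_le_one {c p : ℝ} (hp : |p| ≤ 1) : |c * p| ≤ |c| := by
  rw [abs_mul]
  exact mul_le_of_le_one_right (abs_nonneg _) hp

namespace IsSeparated

/-- The delicate points are `h_j ± ε`, where the domain of one profile ends and nothing is known
beyond. There the cut-off factor tends to `0` against a bounded profile, and past that point it
vanishes identically. -/
theorem continuousAt_piece (hs : IsSeparated ε h) (hχ : IsCutoff χ) (hε : 0 < ε) {j : ℕ}
    (hj1 : 1 ≤ j) (hj : j ≤ N) {x : ℝ} (hx : x ∈ Icc (mid h j) (mid h (j + 1))) :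
    ContinuousAt (piece a χ ε h j) x := by
  have hp := hs.isBoundedProfile_left (a := a) hε hj1 hj
  have hq := hs.isBoundedProfile_right (a := a) hε hj1 hj
  have hc : Continuous fun y => χ ((y - pos h j) / ε) :=
    hχ.smooth.continuous.comp (by fun_prop)
  have h1 := hs.mid_add_lt_pos hj1 hj
  have h2 := hs.pos_add_lt_mid hj1 hj
  refine ContinuousAt.add ?_ ?_
  · rcases lt_or_ge x (pos h j + ε) with hlt | hge
    · exact (hc.continuousAt.const_sub 1).mul (hp.hasDerivAt x ⟨by linarith [hx.1], hlt⟩).continuousAt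
    · refine continuousAt_mul_of_abs_le (hc.continuousAt.const_sub 1)
        (by rw [hχ.eq_one_of_le hε hge, sub_self]) ?_
      filter_upwards [Ioi_mem_nhds (show mid h j - ε < x by linarith [hx.1])] with y hy
      rcases lt_or_ge y (pos h j + ε) with hlt' | hge'
      · exact abs_mul_le_of_abs_le_one (hp.abs_le y ⟨hy, hlt'⟩)
      · simp [hχ.eq_one_of_le hε hge']
  · rcases lt_or_ge (pos h j - ε) x with hlt | hge
    · exact hc.continuousAt.mul (hq.hasDerivAt x ⟨hlt, by linarith [hx.2]⟩).continuousAt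
    · refine continuousAt_mul_of_abs_le hc.continuousAt (hχ.eq_zero_of_le hε hge) ?_
      filter_upwards [Iio_mem_nhds (show x < mid h (j + 1) + ε by linarith [hx.2])] with y hy
      rcases lt_or_ge (pos h j - ε) y with hlt' | hge'
      · exact abs_mul_le_of_abs_le_one (hq.abs_le y ⟨hlt', hy⟩)
      · simp [hχ.eq_zero_of_le hε hge']

theorem hasBoundedJet_piece (hs : IsSeparated ε h) (hχ : IsCutoff χ) (hε : 0 < ε) {X : ℝ}
    (hX0 : 0 ≤ X) (hX : ∀ y ∈ Icc (-1 : ℝ) 1, |deriv χ y| ≤ X ∧ |deriv (deriv χ) y| ≤ X)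
    {j : ℕ} (hj1 : 1 ≤ j) (hj : j ≤ N) {x : ℝ} (hx : x ∈ Ioo (mid h j) (mid h (j + 1)))
    (hx1 : x ≠ pos h j - ε) (hx2 : x ≠ pos h j + ε) :
    HasBoundedJet ((1 + 2 * X) / ε) ((1 + 6 * X) / ε ^ 2) (piece a χ ε h j) x := by
  have hp := hs.isBoundedProfile_left (a := a) hε hj1 hj
  have hq := hs.isBoundedProfile_right (a := a) hε hj1 hj
  have h1 := hs.mid_add_lt_pos hj1 hj
  have h2 := hs.pos_add_lt_mid hj1 hj
  have m1 : 1 / ε ≤ (1 + 2 * X) / ε := by gcongr; linarith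
  have m2 : 1 / ε ^ 2 ≤ (1 + 6 * X) / ε ^ 2 := by gcongr; linarith
  rcases lt_or_gt_of_ne hx1 with hlt | hgt
  · refine ((hp.hasBoundedJet (Ioo_mem_nhds ?_ ?_)).mono m1 m2).congr ?_
    · linarith [hx.1]
    · linarith
    · filter_upwards [Iio_mem_nhds hlt] with y hy
      exact hχ.piece_of_le hε (le_of_lt hy)
  rcases lt_or_gt_of_ne hx2 with hlt2 | hgt2
  · have hsub1 : Ioo (pos h j - ε) (pos h j + ε) ⊆ Ioo (mid h j - ε) (pos h j + ε) :=
      Ioo_subset_Ioo (by linarith) le_rfl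
    have hsub2 : Ioo (pos h j - ε) (pos h j + ε) ⊆ Ioo (pos h j - ε) (mid h (j + 1) + ε) :=
      Ioo_subset_Ioo le_rfl (by linarith)
    exact hasBoundedJet_blend hχ hX hε (abs_le.2 ⟨by linarith, by linarith⟩)
      (Ioo_mem_nhds hgt hlt2) (hp.mono hsub1) (hq.mono hsub2)
  · refine ((hq.hasBoundedJet (Ioo_mem_nhds ?_ ?_)).mono m1 m2).congr ?_
    · linarith
    · linarith [hx.2]
    · filter_upwards [Ioi_mem_nhds hgt2] with y hy
      exact hχ.piece_of_ge hε (le_of_lt hy)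

theorem uh_eq_piece (hs : IsSeparated ε h) (hχ : IsCutoff χ) (hε : 0 < ε) {j : ℕ}
    (hj1 : 1 ≤ j) (hj : j ≤ N) {x : ℝ} (hx : x ∈ Icc (mid h j) (mid h (j + 1))) :
    uh a χ ε h x = piece a χ ε h j x := by
  classical
  have H : ∃ j, 1 ≤ j ∧ j ≤ N ∧ x ∈ Icc (mid h j) (mid h (j + 1)) := ⟨j, hj1, hj, hx⟩
  have hu : uh a χ ε h x = piece a χ ε h (Nat.find H) x := by
    rw [uh, dif_pos H]
  rw [hu]
  obtain ⟨k1, kN, kx⟩ := Nat.find_spec H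
  have hle : Nat.find H ≤ j := Nat.find_min' H ⟨hj1, hj, hx⟩
  generalize Nat.find H = k at k1 kN kx hle
  rcases hle.eq_or_lt with rfl | hlt
  · rfl
  -- Two intervals can only meet at a common `m_{k+1}`, where the cut-offs reduce both pieces to the
  -- same profile `φ^{k+1}`.
  · obtain rfl : k + 1 = j := by
      by_contra hne
      have := hs.mid_lt_mid hε (i := k + 1) (j := j) (by omega) (by omega) (by omega)
      linarith [kx.2, hx.1]
    have := hs.pos_add_lt_mid k1 kN
    have := hs.mid_add_lt_pos hj1 hj
    rw [hχ.piece_of_ge hε (by linarith [hx.1]), hχ.piece_of_le hε (by linarith [kx.2])]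

theorem continuousOn_uh (hs : IsSeparated ε h) (hχ : IsCutoff χ) (hε : 0 < ε) :
    ContinuousOn (uh a χ ε h) (Icc 0 1) := by
  have key : ∀ n, 1 ≤ n → n ≤ N + 1 → ContinuousOn (uh a χ ε h) (Icc (mid h 1) (mid h n)) := by
    intro n hn
    induction n, hn using Nat.le_induction with
    | base => intro _; simp
    | succ k hk ih =>
      intro hkN
      have h1 : mid h 1 ≤ mid h k := by
        rcases hk.eq_or_lt with rfl | hlt
        · rfl
        · exact (hs.mid_lt_mid hε le_rfl hlt (by omega)).le
      rw [← Icc_union_Icc_eq_Icc h1 (hs.mid_lt_mid hε hk (by omega) hkN).le]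
      refine (ih (by omega)).union_of_isClosed ?_ isClosed_Icc isClosed_Icc
      refine ContinuousOn.congr (f := piece a χ ε h k) (fun x hx => ?_)
        fun x hx => hs.uh_eq_piece hχ hε hk (by omega) hx
      exact (hs.continuousAt_piece hχ hε hk (by omega) hx).continuousWithinAt
  have := key (N + 1) (by omega) le_rfl
  rwa [mid_one, mid_add_one hs.one_le] at this

theorem exists_mem_Ico (hs : IsSeparated ε h) {x : ℝ} (hx : x ∈ Ico (0 : ℝ) 1) :
    ∃ j, 1 ≤ j ∧ j ≤ N ∧ x ∈ Ico (mid h j) (mid h (j + 1)) := by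
  have key : ∀ n, 1 ≤ n → x < mid h n → ∃ j, 1 ≤ j ∧ j < n ∧ x ∈ Ico (mid h j) (mid h (j + 1)) := by
    intro n hn
    induction n, hn using Nat.le_induction with
    | base =>
      intro hlt
      rw [mid_one] at hlt
      exact absurd hx.1 (not_le.2 hlt)
    | succ k hk ih =>
      intro hlt
      rcases lt_or_ge x (mid h k) with hl | hg
      · obtain ⟨j, j1, jk, jx⟩ := ih hl
        exact ⟨j, j1, by omega, jx⟩
      · exact ⟨k, hk, by omega, hg, hlt⟩
  obtain ⟨j, j1, jN, jx⟩ := key (N + 1) (by omega) (by rw [mid_add_one hs.one_le]; exact hx.2)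
  exact ⟨j, j1, by omega, jx⟩

theorem exists_countable_hasBoundedJet_uh (hs : IsSeparated ε h) (hχ : IsCutoff χ) (hε : 0 < ε)
    {X : ℝ} (hX0 : 0 ≤ X)
    (hX : ∀ y ∈ Icc (-1 : ℝ) 1, |deriv χ y| ≤ X ∧ |deriv (deriv χ) y| ≤ X) :
    ∃ s : Set ℝ, s.Countable ∧ ∀ x ∈ Ioo (0 : ℝ) 1 \ s,
      HasBoundedJet ((1 + 2 * X) / ε) ((1 + 6 * X) / ε ^ 2) (uh a χ ε h) x := by
  refine ⟨range (mid h) ∪ (range (fun j => pos h j - ε) ∪ range (fun j => pos h j + ε)),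
    (countable_range _).union ((countable_range _).union (countable_range _)), ?_⟩
  rintro x ⟨hx, hxs⟩
  simp only [mem_union, mem_range, not_or, not_exists] at hxs
  obtain ⟨j, j1, jN, jx⟩ := hs.exists_mem_Ico ⟨hx.1.le, hx.2⟩
  have jx' : x ∈ Ioo (mid h j) (mid h (j + 1)) := ⟨jx.1.lt_of_ne (hxs.1 j), jx.2⟩
  refine (hs.hasBoundedJet_piece (a := a) hχ hε hX0 hX j1 jN jx' (fun he => hxs.2.1 j he.symm)
    fun he => hxs.2.2 j he.symm).congr ?_
  filter_upwards [Ioo_mem_nhds jx'.1 jx'.2] with y hy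
  exact hs.uh_eq_piece hχ hε j1 jN (Ioo_subset_Icc_self hy)

end IsSeparated

end Layers

/-! ### From bounds on `u^h` to the eigenvalue estimate. -/

theorem neg_one_le_f' (u : ℝ) : -1 ≤ f' u := by
  rw [f']
  nlinarith [sq_nonneg u]

theorem integrable_vol01_of_ae_bound {g : ℝ → ℝ} (hg : Measurable g) {M : ℝ}
    (h : ∀ᵐ x ∂vol01, |g x| ≤ M) : Integrable g vol01 :=
  Integrable.of_bound hg.aestronglyMeasurable M h

/-- Countability of `s` matters: for a continuous function the fundamental theorem of calculus
tolerates a countable exceptional set, but not an arbitrary null set. -/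
theorem absolutelyContinuous_of_hasBoundedJet {u : ℝ → ℝ} {A B : ℝ} {s : Set ℝ}
    (hu : ContinuousOn u (Icc 0 1)) (hs : s.Countable)
    (hj : ∀ x ∈ Ioo (0 : ℝ) 1 \ s, HasBoundedJet A B u x) :
    AbsolutelyContinuousOnInterval (fun x => f' (u x)) 0 1 ∧
      ∀ᵐ x ∂vol01, |iteratedDeriv 2 (fun y => f' (u y)) x| ≤ 6 * A ^ 2 + 6 * B := by
  have hae : ∀ᵐ x ∂vol01, x ∈ Ioo (0 : ℝ) 1 \ s := by
    filter_upwards [ae_restrict_mem measurableSet_Ioo, hs.ae_notMem vol01] with x h1 h2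
    exact ⟨h1, h2⟩
  have hint : IntervalIntegrable (deriv fun x => f' (u x)) volume 0 1 := by
    rw [intervalIntegrable_iff_vol01]
    refine integrable_vol01_of_ae_bound (measurable_deriv _) (M := 6 * A) ?_
    filter_upwards [hae] with x hx using (hj x hx).f'_comp.2.1
  have hc : ContinuousOn (fun x => f' (u x)) (Icc 0 1) := by
    unfold f'
    exact ((hu.pow 2).const_smul (3 : ℝ)).sub continuousOn_const
  refine ⟨(isPrimitive_of_eq_integral hint fun x hx => ?_).1, ?_⟩
  · have hsub : uIcc 0 x ⊆ Icc 0 1 := by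
      rw [uIcc_of_le hx.1]
      exact Icc_subset_Icc le_rfl hx.2
    have hft := integral_eq_of_hasDerivAt_off_countable (fun x => f' (u x))
      (deriv fun x => f' (u x)) hs (hc.mono hsub) (fun y hy => ?_) (hint.mono_set ?_)
    · rw [hft]
      ring
    · rw [min_eq_left hx.1, max_eq_right hx.1] at hy
      exact (hj y ⟨⟨hy.1.1, hy.1.2.trans_le hx.2⟩, hy.2⟩).f'_comp.1.hasDerivAt
    · rwa [uIcc_of_le zero_le_one]
  · filter_upwards [hae] with x hx using (hj x hx).f'_comp.2.2

theorem le_of_isEigenvalue_graphS {δ μ ε K C₀ lam : ℝ} {u : ℝ → ℝ}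
    (hW : AbsolutelyContinuousOnInterval (fun x => f' (u x)) 0 1)
    (hV : ∀ᵐ x ∂vol01, |iteratedDeriv 2 (fun y => f' (u y)) x| ≤ K / ε ^ 2)
    (hε : 0 < ε) (hδ : 0 < δ) (hμ : 0 < μ) (hC₀ : 0 < C₀) (hK : 0 ≤ K)
    (hδμ : C₀ * δ ≤ ε ^ 2 * μ)
    (h : IsEigenvalue (friedrichsGraph (graphS δ μ ε u)) lam) :
    lam ≤ (1 + (1 / 4 + K / 2) / C₀) * μ := by
  have hVi : Integrable (iteratedDeriv 2 fun y => f' (u y)) vol01 := by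
    refine integrable_vol01_of_ae_bound ?_ hV
    rw [iteratedDeriv_succ]
    exact measurable_deriv _
  have hform : ∀ p ∈ graphS δ μ ε u, ∃ φ : Fin 5 → ℝ → ℝ, IsH4 φ ∧ φ 1 0 = 0 ∧ φ 1 1 = 0 ∧
      p.1 =ᵐ[vol01] φ 0 ∧ ∀ q : L2 × L2, ∀ ψ : Fin 5 → ℝ → ℝ, IsH4 ψ → ψ 1 0 = 0 → ψ 1 1 = 0 →
        q.1 =ᵐ[vol01] ψ 0 → inner ℝ p.2 q.1
          = formS δ μ ε (fun x => f' (u x)) (iteratedDeriv 2 fun y => f' (u y)) φ ψ := by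
    rintro p ⟨φ, hφ, b1, b2, b3, b4, e1, e2⟩
    refine ⟨φ, hφ, b1, b2, e1, fun q ψ hψ c1 c2 e3 => ?_⟩
    rw [← integral_S_mul hW hVi hφ hψ ⟨b1, b2, b3, b4⟩ ⟨c1, c2⟩, L2.inner_def]
    refine integral_congr_ae ?_
    filter_upwards [e2, e3] with x h1 h2
    rw [h1, h2, RCLike.inner_apply, conj_trivial, mul_comm]
  refine le_of_isEigenvalue_friedrichsGraph (fun p hp q hq => ?_) (fun p hp => ?_) h
  · obtain ⟨φ, hφ, b1, b2, e1, h1⟩ := hform p hp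
    obtain ⟨ψ, hψ, c1, c2, e2, h2⟩ := hform q hq
    rw [h1 q ψ hψ c1 c2 e2, h2 p φ hφ b1 b2 e1, formS_comm]
  · obtain ⟨φ, hφ, b1, b2, e1, h1⟩ := hform p hp
    rw [h1 p φ hφ b1 b2 e1, L2.inner_def]
    refine (formS_self_le (by simpa using hW.continuousOn) hVi hε hδ hμ hC₀ hK hδμ
      (fun x => neg_one_le_f' _) (hV.mono fun x hx => le_of_abs_le hx) hφ ⟨b1, b2⟩).trans_eq ?_
    congr 1
    refine integral_congr_ae ?_
    filter_upwards [e1] with x hx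
    rw [hx, RCLike.inner_apply, conj_trivial]

end CHAC

theorem mainTheorem2 (a : ℝ) (ha : CHAC.IsWellRadius a) (χ : ℝ → ℝ) (hχ : CHAC.IsCutoff χ) :
    ∃ ρ₂ : ℝ, 0 < ρ₂ ∧
      ∀ C₀ : ℝ, 0 < C₀ →
        ∃ C : ℝ, 0 < C ∧
          ∀ δ μ : ℝ → ℝ,
            (∀ ε : ℝ, 0 < ε → 0 < δ ε ∧ 0 < μ ε ∧ C₀ * δ ε ≤ ε ^ 2 * μ ε) →
            ∀ N : ℕ, 1 ≤ N →
            ∀ ρ : ℝ, 0 < ρ → ρ ≤ ρ₂ →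
            ∀ ε : ℝ, 0 < ε →
            ∀ h ∈ CHAC.Omega N ρ ε,
            ∀ lam : ℝ,
              CHAC.IsEigenvalue
                (CHAC.friedrichsGraph
                  (CHAC.graphS (δ ε) (μ ε) ε (CHAC.uh a χ ε h))) lam →
              lam ≤ C * μ ε := by
  obtain ⟨X, hX0, hX⟩ := hχ.exists_deriv_bounds
  refine ⟨1 / 2, by norm_num, fun C₀ hC₀ => ?_⟩
  -- Here `K = 6(1 + 2X)² + 6(1 + 6X)` comes from `(f'(u))'' = 6u'² + 6uu''` with the blended
  -- bounds; `X` depends on `χ` alone.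
  refine ⟨1 + (1 / 4 + (6 * (1 + 2 * X) ^ 2 + 6 * (1 + 6 * X)) / 2) / C₀, by positivity, ?_⟩
  intro δ μ hδμ N hN ρ hρ hρ2 ε hε h hh lam hlam
  obtain ⟨hδ, hμ, hle⟩ := hδμ ε hε
  have hs : CHAC.IsSeparated ε h :=
    ⟨hN, fun j hj1 hj => CHAC.two_mul_lt_len hε hρ hρ2 hh hN hj1 hj⟩
  obtain ⟨s, hsc, hjet⟩ := hs.exists_countable_hasBoundedJet_uh (a := a) hχ hε hX0 hX
  obtain ⟨hW, hV⟩ := CHAC.absolutelyContinuous_of_hasBoundedJet (hs.continuousOn_uh hχ hε) hsc hjet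
  refine CHAC.le_of_isEigenvalue_graphS hW (hV.mono fun x hx => hx.trans_eq ?_) hε hδ hμ hC₀
    (by positivity) hle hlam
  ring
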